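/- Let $G$ be a finite simple graph with vertex set $V$ whose independence number (the largest size of a set of pairwise non-adjacent vertices) is at most $2$, let $\overline{G}$ be its complement, let $K$ be a field, and let $S=K[t_v : v\in V]$. For a graph $H$ on $V$, let $I(H)\subset S$ be its edge ideal, generated by the monomials $t_ut_v$ with $\{u,v\}$ an edge of $H$, and let $I_c(H)\subset S$ be its ideal of covers, generated by the monomials $\prod_{v\in C}t_v$ with $C$ an inclusion-minimal vertex cover of $H$ (so $I(H)=(0)$ and $I_c(H)=S$ if $H$ has no edges). An ideal $I\subset S$ is normal if $I^n$ is integrally closed for every $n\ge 1$; here an ideal $J$ is integrally closed if it contains every $x\in S$ that satisfies an equation $x^k+a_1x^{k-1}+\cdots+a_k=0$ with $k\ge 1$ and $a_i\in J^i$ for $1\le i\le k$. A Hochster configuration of $H$ consists of two odd cycles $C_1,C_2$ of $H$, both without chords in $H$, such that no vertex of $C_1$ is adjacent in $H$ to a vertex of $C_2$. Then the following hold. (a) $I_c(G)$ is normal if and only if $I(\overline{G})$ is normal. (b) $I_c(G)$ is normal if and only if $\overline{G}$ has no Hochster configurations. -/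

import Mathlib

/-- `x` is integral over the ideal `I`: it satisfies an equation
`x ^ k + a₁ x ^ (k - 1) + ⋯ + aₖ = 0` with `k ≥ 1` and `aᵢ ∈ I ^ i`. -/
def Ideal.IsIntegralElem {R : Type*} [CommRing R] (I : Ideal R) (x : R) : Prop :=
  ∃ k : ℕ, 1 ≤ k ∧ ∃ a : ℕ → R, (∀ i ∈ Finset.Icc 1 k, a i ∈ I ^ i) ∧
    x ^ k + ∑ i ∈ Finset.Icc 1 k, a i * x ^ (k - i) = 0

/-- The ideal `I` equals its integral closure `{x | x is integral over I}`. -/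
def Ideal.IsIntClosed {R : Type*} [CommRing R] (I : Ideal R) : Prop :=
  {x : R | I.IsIntegralElem x} = (I : Set R)

/-- `I` is a normal ideal: `I ^ n` is integrally closed for every `n ≥ 1`. -/
def Ideal.IsNormalIdeal {R : Type*} [CommRing R] (I : Ideal R) : Prop :=
  ∀ n : ℕ, 1 ≤ n → (I ^ n).IsIntClosed

namespace SimpleGraph

/-- The edge ideal `I(G)` of `G` in the polynomial ring `K[t_v : v ∈ V]`, generated by the
monomials `t_u t_v` with `{u, v}` an edge. -/
noncomputable def edgeIdeal {V : Type*} (K : Type*) [Field K] (G : SimpleGraph V) :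
    Ideal (MvPolynomial V K) :=
  Ideal.span {f | ∃ u v : V, G.Adj u v ∧ f = MvPolynomial.X u * MvPolynomial.X v}

/-- `C` is a vertex cover of `G`, minimal with respect to inclusion. -/
def IsMinimalVertexCover {V : Type*} (G : SimpleGraph V) (C : Finset V) : Prop :=
  Minimal (fun D : Finset V => G.IsVertexCover (D : Set V)) C

/-- The ideal of covers `I_c(G)`, generated by the monomials `∏ v ∈ C, t_v` with `C` a minimal
vertex cover of `G`. (If `G` has no edges, the only minimal cover is `∅` and the ideal is the
whole ring.) -/
noncomputable def coverIdeal {V : Type*} (K : Type*) [Field K] (G : SimpleGraph V) :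
    Ideal (MvPolynomial V K) :=
  Ideal.span {f | ∃ C : Finset V, G.IsMinimalVertexCover C ∧ f = ∏ v ∈ C, MvPolynomial.X v}

/-- The neighbor set `N_G(A)` of a set `A` of vertices: all vertices adjacent to some vertex
of `A`. -/
def neighborsOf {V : Type*} (G : SimpleGraph V) (A : Set V) : Set V :=
  {w | ∃ v ∈ A, G.Adj v w}

/-- The closed walks `p`, `q` of `G` form a Hochster configuration: both are odd cycles without
chords in `G`, and no vertex of `p` is a neighbor of a vertex of `q`. -/
def IsHochsterConfiguration {V : Type*} (G : SimpleGraph V) {u v : V}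
    (p : G.Walk u u) (q : G.Walk v v) : Prop :=
  p.IsCycle ∧ q.IsCycle ∧ Odd p.length ∧ Odd q.length ∧
    {w | w ∈ p.support} ∩ G.neighborsOf {w | w ∈ q.support} = ∅ ∧
    p.IsChordless ∧ q.IsChordless

/-- Some pair of cycles of `G` is a Hochster configuration. -/
def HasHochsterConfiguration {V : Type*} (G : SimpleGraph V) : Prop :=
  ∃ (u v : V) (p : G.Walk u u) (q : G.Walk v v), G.IsHochsterConfiguration p q

end SimpleGraph

/-!
Write `H` for the complement of `G`. Exponent vectors of monomials are encoded as multisets of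
vertices.

*Reduction to monomials.* Normality of a monomial ideal may be tested on monomials: `I` is normal
as soon as `x ^ (k • A) ∈ I ^ (k * n)` with `k ≥ 1` implies `x ^ A ∈ I ^ n`
(`isNormalIdeal_monomialIdeal_iff`). If `f` is integral over `J`, its powers lie in the powers of
`J` up to a bounded defect. The leading monomial of `f` has the same property, Dickson's lemma
removes the defect, and the leading term can then be subtracted without harm
(`mem_monomialIdeal_pow_of_pow_sub_mem`).

*The equivalence of the two ideals.* For the edge ideal of `H`, `x ^ A ∈ I ^ n` says that `H` has a
matching with `n` edges for the vertex capacities `A`. For the cover ideal of `G` it says that `n`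
complements of cliques of `H` sum to at most `A`, that is, that `n` cliques of `H` meet the demands
`B v = n - A v`. As cliques of `H` have at most two vertices, Gallai's duality turns this into a
matching of `H` of size `|B| - n` within `B` (`dominatesSum_coverExponents_iff`). The translation
commutes with scaling by `k`, so the two normality conditions agree.

*Edge ideals and Hochster configurations.* A fractional matching of size `n` lifts to the bipartite
double cover of `H`, where Hall's theorem replaces it by `2 * n` arcs with in- and out-degrees
bounded by the capacities (`HasCapMatching.exists_arcs`). Unbalanced vertices allow an edge to be
split off greedily; otherwise the arcs decompose into directed cycles, of which the even ones have
perfect matchings. Two odd ones contain chordless odd cycles, so without a Hochster configuration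
they are joined by an edge and have a perfect matching together (`hasCapMatching_of_arcs`).
Conversely, the vertex set of a Hochster configuration has a fractional perfect matching, and no
integral one by parity (`not_hasHochsterConfiguration_of_forall_hasCapMatching`).
-/

/-! ### Powers of monomial ideals and their integral closures -/

section MonomialIdeal

open MvPolynomial

variable {V : Type*} (K : Type*) [Field K]

/-- The monomial ideal generated by the monomials with exponents in `𝓔`. Exponent vectors are
encoded as multisets of variables. -/
noncomputable def monomialIdeal (𝓔 : Set (Multiset V)) : Ideal (MvPolynomial V K) :=
  Ideal.span ((fun A : Multiset V => (A.map X).prod) '' 𝓔)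

/-- The exponent vector `A` dominates a sum of `n` members of `𝓔` (with repetition); equivalently,
the monomial with exponent `A` lies in the `n`-th power of `monomialIdeal K 𝓔`. -/
def DominatesSum (𝓔 : Set (Multiset V)) (n : ℕ) (A : Multiset V) : Prop :=
  ∃ s : Multiset (Multiset V), Multiset.card s = n ∧ (∀ e ∈ s, e ∈ 𝓔) ∧ s.sum ≤ A

theorem Multiset.prod_map_X [DecidableEq V] (A : Multiset V) :
    (A.map (X : V → MvPolynomial V K)).prod = monomial (Multiset.toFinsupp A) 1 := by
  induction A using Multiset.induction_on with
  | empty => simp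
  | cons v A ih =>
    rw [Multiset.map_cons, Multiset.prod_cons, ih, X, monomial_mul, one_mul,
      ← Multiset.singleton_add, Multiset.toFinsupp_add, Multiset.toFinsupp_singleton]

theorem monomialIdeal_pow (𝓔 : Set (Multiset V)) (n : ℕ) :
    monomialIdeal K 𝓔 ^ n = monomialIdeal K
      {A | ∃ s : Multiset (Multiset V), Multiset.card s = n ∧ (∀ e ∈ s, e ∈ 𝓔) ∧ s.sum = A} := by
  induction n with
  | zero =>
    rw [pow_zero, Ideal.one_eq_top, eq_comm, Ideal.eq_top_iff_one]
    exact Ideal.subset_span ⟨0, ⟨0, by simp⟩, by simp⟩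
  | succ n ih =>
    rw [pow_succ, ih]
    simp only [monomialIdeal]
    rw [Ideal.span_mul_span']
    congr 1
    ext f
    simp only [Set.mem_mul, Set.mem_image, Set.mem_ofPred_eq]
    constructor
    · rintro ⟨_, ⟨_, ⟨s, hs, hs', rfl⟩, rfl⟩, _, ⟨e, he, rfl⟩, rfl⟩
      refine ⟨_, ⟨e ::ₘ s, by simp [hs], ?_, rfl⟩, ?_⟩
      · simpa [he] using hs'
      · simp [mul_comm]
    · rintro ⟨_, ⟨s, hs, hs', rfl⟩, rfl⟩
      obtain ⟨e, he⟩ := Multiset.card_pos_iff_exists_mem.mp (by omega : 0 < Multiset.card s)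
      obtain ⟨t, rfl⟩ := Multiset.exists_cons_of_mem he
      refine ⟨_, ⟨_, ⟨t, by simpa using hs, fun x hx => hs' x (by simp [hx]), rfl⟩, rfl⟩,
        _, ⟨e, hs' e (by simp), rfl⟩, ?_⟩
      simp [mul_comm]

variable {K}

theorem mem_monomialIdeal_pow {𝓔 : Set (Multiset V)} {n : ℕ} {f : MvPolynomial V K} :
    f ∈ monomialIdeal K 𝓔 ^ n ↔ ∀ a ∈ f.support, DominatesSum 𝓔 n (Finsupp.toMultiset a) := by
  classical
  rw [monomialIdeal_pow, monomialIdeal]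
  simp only [Multiset.prod_map_X]
  rw [← Set.image_image (fun a => monomial a (1 : K)) (fun A => Multiset.toFinsupp A),
    mem_ideal_span_monomial_image]
  refine forall₂_congr fun a _ => ?_
  simp only [Set.mem_image, Set.mem_ofPred_eq, DominatesSum]
  constructor
  · rintro ⟨_, ⟨_, ⟨s, h1, h2, rfl⟩, rfl⟩, h⟩
    refine ⟨s, h1, h2, ?_⟩
    have := Finsupp.orderIsoMultiset.monotone h
    simpa using this
  · rintro ⟨s, h1, h2, h⟩
    refine ⟨_, ⟨_, ⟨s, h1, h2, rfl⟩, rfl⟩, ?_⟩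
    have := Finsupp.orderIsoMultiset.symm.monotone h
    simpa using this

theorem monomial_mem_monomialIdeal_pow [DecidableEq V] {𝓔 : Set (Multiset V)} {n : ℕ}
    {A : Multiset V} {c : K} (hc : c ≠ 0) :
    monomial (Multiset.toFinsupp A) c ∈ monomialIdeal K 𝓔 ^ n ↔ DominatesSum 𝓔 n A := by
  classical
  rw [mem_monomialIdeal_pow, support_monomial, if_neg hc]
  simp

theorem Multiset.wellQuasiOrderedLE (ι : Type*) [Finite ι] :
    WellQuasiOrderedLE (Multiset ι) := by
  classical
  exact (Finsupp.orderIsoMultiset (ι := ι)).monotone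
    |>.wellQuasiOrderedLE_of_wellQuasiOrderedLE_of_surjective
      (Finsupp.orderIsoMultiset (ι := ι)).surjective

/-- If `(k + d) • A` dominates a sum of `k * n` members of a finite set for every `k`, then
the bounded defect `d` can be removed for some `k > 0`. By Dickson's lemma two of the
decompositions, slack included, are comparable, and their difference is a decomposition without
defect. -/
theorem DominatesSum.exists_of_forall_add [Finite V] {𝓔 : Set (Multiset V)} (h𝓔 : 𝓔.Finite)
    {n d : ℕ} {A : Multiset V} (h : ∀ k, DominatesSum 𝓔 (n * k) ((k + d) • A)) :
    ∃ k, 1 ≤ k ∧ DominatesSum 𝓔 (k * n) (k • A) := by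
  have : Finite 𝓔 := h𝓔
  have h' : ∀ k, ∃ p : Multiset 𝓔 × Multiset V, Multiset.card p.1 = n * k ∧
      (p.1.map Subtype.val).sum + p.2 = (k + d) • A := by
    intro k
    obtain ⟨s, hs, hs', hle⟩ := h k
    lift s to Multiset 𝓔 using hs'
    obtain ⟨r, hr⟩ := Multiset.le_iff_exists_add.mp hle
    exact ⟨(s, r), by simpa using hs, hr.symm⟩
  choose p hp hsum using h'
  have := Multiset.wellQuasiOrderedLE 𝓔
  have := Multiset.wellQuasiOrderedLE V
  obtain ⟨i, j, hij, hle⟩ := wellQuasiOrdered_le p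
  obtain ⟨t, ht⟩ := Multiset.le_iff_exists_add.mp hle.1
  obtain ⟨r, hr⟩ := Multiset.le_iff_exists_add.mp hle.2
  obtain ⟨k, rfl⟩ := Nat.exists_eq_add_of_lt hij
  refine ⟨k + 1, by omega, t.map Subtype.val, ?_, by simp +contextual, ?_⟩
  · have h1 := hp (i + k + 1)
    rw [ht, Multiset.card_add, hp i] at h1
    rw [Multiset.card_map]
    linarith
  · have h1 := hsum (i + k + 1)
    have h2 : (i + k + 1 + d) • A = (i + d) • A + (k + 1) • A := by
      rw [← add_smul]; congr 1; ring
    rw [ht, hr, Multiset.map_add, Multiset.sum_add, h2, ← hsum i] at h1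
    rw [Multiset.le_iff_exists_add]
    refine ⟨r, ?_⟩
    have h3 : ((p i).1.map Subtype.val).sum + (p i).2 + (k + 1) • A =
        ((p i).1.map Subtype.val).sum + (p i).2 + ((t.map Subtype.val).sum + r) := by
      rw [← h1]; abel
    exact add_left_cancel h3

theorem Ideal.pow_sub_mem_of_isIntegralElem {R : Type*} [CommRing R] {J : Ideal R} {x : R}
    (hx : J.IsIntegralElem x) : ∃ d, ∀ j, x ^ j ∈ J ^ (j - d) := by
  obtain ⟨k, -, a, ha, h⟩ := hx
  refine ⟨k, fun j => ?_⟩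
  induction j using Nat.strong_induction_on with
  | _ j ih =>
    rcases lt_or_ge j k with hj | hj
    · simp [Nat.sub_eq_zero_of_le hj.le]
    · have hx : x ^ j = -∑ i ∈ Finset.Icc 1 k, a i * x ^ (j - i) := by
        rw [← Nat.sub_add_cancel hj, pow_add, eq_neg_of_add_eq_zero_left h, mul_neg,
          Finset.mul_sum]
        congr 1
        refine Finset.sum_congr rfl fun i hi => ?_
        rw [Finset.mem_Icc] at hi
        rw [mul_left_comm, ← pow_add]
        congr 2
        omega
      rw [hx]
      refine neg_mem (Ideal.sum_mem _ fun i hi => ?_)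
      have hi' := Finset.mem_Icc.mp hi
      have := Ideal.mul_mem_mul (ha i hi) (ih (j - i) (by omega))
      rw [← pow_add] at this
      exact Ideal.pow_le_pow_right (by omega) this

theorem Ideal.pow_sub_mem_add {R : Type*} [CommRing R] {J : Ideal R} {x y : R} {d : ℕ}
    (hx : ∀ j, x ^ j ∈ J ^ (j - d)) (hy : y ∈ J) (j : ℕ) : (x + y) ^ j ∈ J ^ (j - d) := by
  rw [add_pow]
  refine Ideal.sum_mem _ fun i hi => Ideal.mul_mem_right _ _ ?_
  have := Ideal.mul_mem_mul (hx i) (Ideal.pow_mem_pow hy (j - i))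
  rw [← pow_add] at this
  rw [Finset.mem_range] at hi
  exact Ideal.pow_le_pow_right (by omega) this

/-- An element whose powers lie in the powers of `J = monomialIdeal K 𝓔 ^ n` up to a bounded
defect lies in `J`, provided that `J` contains every monomial integral over it. The leading
monomial inherits the hypothesis and so lies in `J`; subtracting it preserves the hypothesis. -/
theorem mem_monomialIdeal_pow_of_pow_sub_mem [Finite V] {𝓔 : Set (Multiset V)} (h𝓔 : 𝓔.Finite)
    {n : ℕ} (h : ∀ (A : Multiset V) (k : ℕ), 1 ≤ k → DominatesSum 𝓔 (k * n) (k • A) →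
      DominatesSum 𝓔 n A) {d : ℕ} (f : MvPolynomial V K)
    (hf : ∀ j, f ^ j ∈ (monomialIdeal K 𝓔 ^ n) ^ (j - d)) : f ∈ monomialIdeal K 𝓔 ^ n := by
  classical
  let _ : LinearOrder V := linearOrderOfSTO (WellOrderingRel (α := V))
  let m : MonomialOrder V := MonomialOrder.lex
  induction hN : f.support.card using Nat.strong_induction_on generalizing f with
  | _ N ih =>
    rcases eq_or_ne f 0 with rfl | hf0
    · exact zero_mem _
    have hlead : monomial (m.degree f) (coeff (m.degree f) f) ∈ monomialIdeal K 𝓔 ^ n := by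
      have hA : Multiset.toFinsupp (Finsupp.toMultiset (m.degree f)) = m.degree f := by simp
      have hc : coeff (m.degree f) f ≠ 0 := m.leadingCoeff_ne_zero_iff.mpr hf0
      rw [← hA] at hc ⊢
      rw [monomial_mem_monomialIdeal_pow hc]
      obtain ⟨k, hk, hk'⟩ := DominatesSum.exists_of_forall_add h𝓔 (n := n) (d := d)
        (A := Finsupp.toMultiset (m.degree f)) fun k => by
          have h1 := hf (k + d)
          rw [← pow_mul, Nat.add_sub_cancel, mem_monomialIdeal_pow] at h1
          have h2 := h1 (m.degree (f ^ (k + d))) (m.degree_mem_support (pow_ne_zero _ hf0))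
          rwa [m.degree_pow, map_nsmul] at h2
      exact h _ k hk hk'
    have hcard : (f - monomial (m.degree f) (coeff (m.degree f) f)).support.card < N := by
      rw [← hN]
      refine Finset.card_lt_card ((Finset.ssubset_iff_of_subset ?_).mpr
        ⟨m.degree f, m.degree_mem_support hf0, by simp⟩)
      intro a ha
      rw [mem_support_iff] at ha ⊢
      contrapose! ha
      rw [coeff_sub, coeff_monomial, ha]
      split_ifs with h
      · rw [h, ha, sub_zero]
      · simp
    have := ih _ hcard _ (fun j => by
      rw [sub_eq_add_neg]
      exact Ideal.pow_sub_mem_add hf (neg_mem hlead) j) rfl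
    simpa using add_mem this hlead

/-- Normality of a monomial ideal only has to be tested on monomials. -/
theorem isNormalIdeal_monomialIdeal_iff [Finite V] {𝓔 : Set (Multiset V)} (h𝓔 : 𝓔.Finite) :
    (monomialIdeal K 𝓔).IsNormalIdeal ↔ ∀ n, 1 ≤ n → ∀ (A : Multiset V) (k : ℕ), 1 ≤ k →
      DominatesSum 𝓔 (k * n) (k • A) → DominatesSum 𝓔 n A := by
  classical
  constructor
  · intro hI n hn A k hk h
    rw [← monomial_mem_monomialIdeal_pow (K := K) one_ne_zero, ← SetLike.mem_coe, ← hI n hn]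
    refine ⟨k, hk, fun i => if i = k then -(monomial (Multiset.toFinsupp A) 1) ^ k else 0, ?_, ?_⟩
    · intro i _
      dsimp only
      split_ifs with hi
      · subst hi
        rw [← pow_mul, neg_mem_iff, monomial_pow, one_pow, ← map_nsmul,
          monomial_mem_monomialIdeal_pow one_ne_zero, mul_comm]
        exact h
      · exact zero_mem _
    · simp only [ite_mul, zero_mul]
      rw [Finset.sum_ite_eq', if_pos (Finset.mem_Icc.mpr ⟨hk, le_rfl⟩)]
      simp
  · intro h n hn
    ext x
    constructor
    · intro hx
      obtain ⟨d, hd⟩ := Ideal.pow_sub_mem_of_isIntegralElem hx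
      exact mem_monomialIdeal_pow_of_pow_sub_mem h𝓔 (h n hn) x hd
    · intro hx
      refine ⟨1, le_rfl, fun _ => -x, fun i hi => ?_, by simp⟩
      obtain rfl : i = 1 := by simpa using hi
      rw [pow_one]
      exact neg_mem hx

end MonomialIdeal

/-! ### Matchings with vertex capacities and the two monomial ideals -/

theorem Multiset.sum_map_singleton_apply {α β : Type*} (s : Multiset α) (f : α → β) :
    (s.map fun a => ({f a} : Multiset β)).sum = s.map f := by
  rw [← Multiset.sum_map_singleton (s.map f), Multiset.map_map]
  rfl

namespace SimpleGraph

variable {V : Type*}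

/-- `H` has a matching with `n` edges (with repetition) with respect to the vertex capacities `A`:
every vertex is covered at most as often as it occurs in `A`. Each edge is listed once, as an
ordered pair of its ends, in either order. -/
def HasCapMatching (H : SimpleGraph V) (n : ℕ) (A : Multiset V) : Prop :=
  ∃ M : Multiset (V × V), Multiset.card M = n ∧ (∀ e ∈ M, H.Adj e.1 e.2) ∧
    M.map Prod.fst + M.map Prod.snd ≤ A

variable {H : SimpleGraph V}

theorem HasCapMatching.zero (A : Multiset V) : H.HasCapMatching 0 A := ⟨0, by simp⟩

theorem HasCapMatching.mono {m n : ℕ} {A B : Multiset V} (h : H.HasCapMatching n A) (hmn : m ≤ n)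
    (hAB : A ≤ B) : H.HasCapMatching m B := by
  obtain ⟨M, rfl, hM, hle⟩ := h
  obtain ⟨T, hT, rfl⟩ : ∃ T ≤ M, Multiset.card T = m := by
    induction M using Quotient.inductionOn with
    | _ l => exact ⟨l.take m, (List.take_sublist _ _).subperm, by simpa using hmn⟩
  exact ⟨T, rfl, fun e he => hM e (Multiset.mem_of_le hT he),
    (add_le_add (Multiset.map_le_map hT) (Multiset.map_le_map hT)).trans (hle.trans hAB)⟩

theorem HasCapMatching.add {m n : ℕ} {A B : Multiset V} (h : H.HasCapMatching m A)
    (h' : H.HasCapMatching n B) : H.HasCapMatching (m + n) (A + B) := by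
  obtain ⟨M, rfl, hM, hle⟩ := h
  obtain ⟨N, rfl, hN, hle'⟩ := h'
  refine ⟨M + N, by simp, ?_, ?_⟩
  · intro e he
    rcases Multiset.mem_add.mp he with he | he
    exacts [hM e he, hN e he]
  · rw [Multiset.map_add, Multiset.map_add, add_add_add_comm]
    exact add_le_add hle hle'

theorem HasCapMatching.pair {u v : V} (h : H.Adj u v) : H.HasCapMatching 1 {u, v} :=
  ⟨{(u, v)}, by simp, by simpa using h, by simp⟩

/-- The exponents of the generators of the edge ideal. -/
def edgeExponents (H : SimpleGraph V) : Set (Multiset V) := {e | ∃ u v, H.Adj u v ∧ e = {u, v}}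

/-- The exponents of the monomials of all vertex covers, minimal or not. -/
def coverExponents (G : SimpleGraph V) : Set (Multiset V) :=
  {e | ∃ C : Finset V, G.IsVertexCover (C : Set V) ∧ e = C.val}

theorem edgeExponents_finite [Finite V] (H : SimpleGraph V) : H.edgeExponents.Finite := by
  refine (Set.finite_range fun p : V × V => ({p.1, p.2} : Multiset V)).subset ?_
  rintro _ ⟨u, v, -, rfl⟩
  exact ⟨(u, v), rfl⟩

theorem coverExponents_finite [Finite V] (G : SimpleGraph V) : G.coverExponents.Finite := by
  refine (Set.finite_range fun C : Finset V => C.val).subset ?_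
  rintro _ ⟨C, -, rfl⟩
  exact ⟨C, rfl⟩

theorem edgeIdeal_eq_monomialIdeal (K : Type*) [Field K] (H : SimpleGraph V) :
    H.edgeIdeal K = monomialIdeal K H.edgeExponents := by
  rw [edgeIdeal, monomialIdeal]
  congr 1
  ext f
  constructor
  · rintro ⟨u, v, h, rfl⟩
    exact ⟨_, ⟨u, v, h, rfl⟩, by simp⟩
  · rintro ⟨_, ⟨u, v, h, rfl⟩, rfl⟩
    exact ⟨u, v, h, by simp⟩

theorem coverIdeal_eq_monomialIdeal (K : Type*) [Field K] (G : SimpleGraph V) :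
    G.coverIdeal K = monomialIdeal K G.coverExponents := by
  rw [coverIdeal, monomialIdeal]
  apply le_antisymm
  · refine Ideal.span_mono ?_
    rintro _ ⟨C, hC, rfl⟩
    exact ⟨_, ⟨C, hC.prop, rfl⟩, rfl⟩
  · rw [Ideal.span_le]
    rintro _ ⟨_, ⟨C, hC, rfl⟩, rfl⟩
    obtain ⟨D, hDC, hD⟩ := exists_minimal_le_of_wellFoundedLT
      (fun D : Finset V => G.IsVertexCover (D : Set V)) C hC
    exact Ideal.mem_of_dvd _ (Finset.prod_dvd_prod_of_subset _ _ _ hDC)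
      (Ideal.subset_span ⟨D, hD, rfl⟩)

theorem dominatesSum_edgeExponents_iff {n : ℕ} {A : Multiset V} :
    DominatesSum H.edgeExponents n A ↔ H.HasCapMatching n A := by
  have key : ∀ M : Multiset (V × V),
      (M.map fun e => ({e.1, e.2} : Multiset V)).sum = M.map Prod.fst + M.map Prod.snd := by
    intro M
    have : (fun e : V × V => ({e.1, e.2} : Multiset V)) = fun e => {e.1} + {e.2} := rfl
    rw [this, Multiset.sum_map_add, Multiset.sum_map_singleton_apply,
      Multiset.sum_map_singleton_apply]
  constructor
  · rintro ⟨s, rfl, hs, hle⟩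
    have : ∃ M : Multiset (V × V), (∀ e ∈ M, H.Adj e.1 e.2) ∧
        M.map (fun e => ({e.1, e.2} : Multiset V)) = s := by
      clear hle
      induction s using Multiset.induction_on with
      | empty => exact ⟨0, by simp⟩
      | cons e s ih =>
        obtain ⟨M, hM, rfl⟩ := ih fun x hx => hs x (Multiset.mem_cons_of_mem hx)
        obtain ⟨u, v, h, rfl⟩ := hs e (Multiset.mem_cons_self _ _)
        refine ⟨(u, v) ::ₘ M, ?_, by simp⟩
        intro e he
        rcases Multiset.mem_cons.mp he with rfl | he
        exacts [h, hM e he]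
    obtain ⟨M, hM, rfl⟩ := this
    exact ⟨M, by simp, hM, key M ▸ hle⟩
  · rintro ⟨M, rfl, hM, hle⟩
    refine ⟨M.map fun e => {e.1, e.2}, by simp, ?_, (key M).symm ▸ hle⟩
    intro x hx
    obtain ⟨e, he, rfl⟩ := Multiset.mem_map.mp hx
    exact ⟨_, _, hM e he, rfl⟩

theorem isNormalIdeal_edgeIdeal_iff [Finite V] (K : Type*) [Field K] (H : SimpleGraph V) :
    (H.edgeIdeal K).IsNormalIdeal ↔ ∀ n, 1 ≤ n → ∀ (A : Multiset V) (k : ℕ), 1 ≤ k →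
      H.HasCapMatching (k * n) (k • A) → H.HasCapMatching n A := by
  rw [edgeIdeal_eq_monomialIdeal, isNormalIdeal_monomialIdeal_iff H.edgeExponents_finite]
  simp only [dominatesSum_edgeExponents_iff]

theorem isNormalIdeal_coverIdeal_iff [Finite V] (K : Type*) [Field K] (G : SimpleGraph V) :
    (G.coverIdeal K).IsNormalIdeal ↔ ∀ n, 1 ≤ n → ∀ (A : Multiset V) (k : ℕ), 1 ≤ k →
      DominatesSum G.coverExponents (k * n) (k • A) → DominatesSum G.coverExponents n A := by
  rw [coverIdeal_eq_monomialIdeal, isNormalIdeal_monomialIdeal_iff G.coverExponents_finite]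

/-! ### Covers of a graph versus matchings of its complement -/

/-- If a multiset of pairs, single vertices and empty sets (each pair being an edge) covers `B`,
then `H` has a matching within `B` of the complementary size: every member of the family that
reduces the remaining demand by two contributes an edge of the matching. -/
theorem hasCapMatching_of_le_sum [DecidableEq V] (q : Multiset (Multiset V))
    (hq : ∀ e ∈ q, e = 0 ∨ (∃ v, e = {v}) ∨ e ∈ H.edgeExponents) (B : Multiset V)
    (hB : B ≤ q.sum) : H.HasCapMatching (Multiset.card B - Multiset.card q) B := by
  induction q using Multiset.induction_on generalizing B with
  | empty =>
    obtain rfl : B = 0 := by simpa using hB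
    simpa using HasCapMatching.zero 0
  | cons e q ih =>
    have hle : B - e ≤ q.sum := by
      rw [Multiset.sum_cons] at hB
      exact tsub_le_iff_left.mpr hB
    have ih' := ih (fun x hx => hq x (Multiset.mem_cons_of_mem hx)) (B - e) hle
    have hcard : Multiset.card B ≤ Multiset.card (B - e) + Multiset.card e := by
      rw [← Multiset.card_add]
      exact Multiset.card_le_card le_tsub_add
    rw [Multiset.card_cons]
    by_cases hsmall : Multiset.card B ≤ Multiset.card (B - e) + 1
    · exact ih'.mono (by omega) tsub_le_self
    · rcases hq e (Multiset.mem_cons_self _ _) with rfl | ⟨v, rfl⟩ | ⟨u, v, huv, rfl⟩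
      · simp at hcard hsmall
      · simp at hcard hsmall; omega
      · have hin : ({u, v} : Multiset V) ≤ B := by
          have h1 : B - {u, v} = B - B ∩ {u, v} := by
            ext x; simp only [Multiset.count_sub, Multiset.count_inter]; omega
          have h2 : Multiset.card (B - {u, v}) = Multiset.card B - Multiset.card (B ∩ {u, v}) := by
            rw [h1, Multiset.card_sub Multiset.inter_le_left]
          have h3 : B ∩ {u, v} = {u, v} := by
            refine Multiset.eq_of_le_of_card_le Multiset.inter_le_right ?_
            have h4 : Multiset.card ({u, v} : Multiset V) = 2 := rfl
            omega
          rw [← h3]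
          exact Multiset.inter_le_left
        have := ih'.add (HasCapMatching.pair huv)
        rw [tsub_add_cancel_of_le hin] at this
        refine this.mono ?_ le_rfl
        have h4 : Multiset.card ({u, v} : Multiset V) = 2 := rfl
        omega

theorem isVertexCover_iff_compl_of_indepNum_le_two [Fintype V] [DecidableEq V]
    {G : SimpleGraph V} (hG : G.indepNum ≤ 2) {C : Finset V} : G.IsVertexCover (C : Set V) ↔
      Cᶜ.val = 0 ∨ (∃ v, Cᶜ.val = {v}) ∨ Cᶜ.val ∈ Gᶜ.edgeExponents := by
  rw [← isIndepSet_compl_iff_isVertexCover, ← Finset.coe_compl]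
  generalize Cᶜ = I
  constructor
  · intro hI
    have hcard := hI.card_le_indepNum.trans hG
    have : I.card = 0 ∨ I.card = 1 ∨ I.card = 2 := by omega
    rcases this with h | h | h
    · exact Or.inl (Multiset.card_eq_zero.mp h)
    · exact Or.inr (Or.inl (Multiset.card_eq_one.mp h))
    · obtain ⟨u, v, huv, rfl⟩ := Finset.card_eq_two.mp h
      refine Or.inr (Or.inr ⟨u, v, ?_, ?_⟩)
      · exact ⟨huv, hI (by simp) (by simp) huv⟩
      · rw [Finset.insert_val_of_notMem (by simpa using huv)]; rfl
  · rintro (h | ⟨v, h⟩ | ⟨u, v, huv, h⟩) x hx y hy hxy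
    · rw [Finset.val_eq_zero.mp h] at hx; simp at hx
    · have hx' : x ∈ I.val := hx
      have hy' : y ∈ I.val := hy
      rw [h, Multiset.mem_singleton] at hx' hy'
      exact absurd (hx'.trans hy'.symm) hxy
    · have hx' : x ∈ I.val := hx
      have hy' : y ∈ I.val := hy
      simp only [h, Multiset.insert_eq_cons, Multiset.mem_cons, Multiset.mem_singleton] at hx' hy'
      have huv' : ¬ G.Adj u v := huv.2
      rcases hx' with rfl | rfl <;> rcases hy' with rfl | rfl
      · exact absurd rfl hxy
      · exact huv'
      · exact fun h => huv' h.symm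
      · exact absurd rfl hxy

/-- Gallai's duality between edge covers and matchings. A sum of `n` vertex covers of `G` is the
complement, in `n` copies of `V`, of a sum of `n` cliques of `Gᶜ`, each with at most two vertices;
such cliques can meet the demands `n • univ.val - A` exactly if `Gᶜ` has a large matching within
these demands. -/
theorem dominatesSum_coverExponents_iff [Fintype V] [DecidableEq V] {G : SimpleGraph V}
    (hG : G.indepNum ≤ 2) {n : ℕ} {A : Multiset V} : DominatesSum G.coverExponents n A ↔
      Gᶜ.HasCapMatching (Multiset.card (n • Finset.univ.val - A) - n)
        (n • Finset.univ.val - A) := by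
  have hcompl : ∀ C : Finset V, C.val + Cᶜ.val = Finset.univ.val := by
    intro C
    rw [← Finset.disjUnion_val _ _ disjoint_compl_right, Finset.disjUnion_eq_union,
      Finset.union_compl]
  constructor
  · rintro ⟨s, rfl, hs, hle⟩
    have : ∃ q : Multiset (Multiset V), Multiset.card q = Multiset.card s ∧
        (∀ e ∈ q, e = 0 ∨ (∃ v, e = {v}) ∨ e ∈ Gᶜ.edgeExponents) ∧
        s.sum + q.sum = Multiset.card s • Finset.univ.val := by
      clear hle
      induction s using Multiset.induction_on with
      | empty => exact ⟨0, by simp⟩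
      | cons e s ih =>
        obtain ⟨q, hq, hq', hsum⟩ := ih fun x hx => hs x (Multiset.mem_cons_of_mem hx)
        obtain ⟨C, hC, rfl⟩ := hs e (Multiset.mem_cons_self _ _)
        refine ⟨Cᶜ.val ::ₘ q, by simp [hq], ?_, ?_⟩
        · intro x hx
          rcases Multiset.mem_cons.mp hx with rfl | hx
          exacts [(isVertexCover_iff_compl_of_indepNum_le_two hG).mp hC, hq' x hx]
        · rw [Multiset.sum_cons, Multiset.sum_cons, add_add_add_comm, hsum, hcompl,
            Multiset.card_cons, add_smul, one_smul, add_comm]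
    obtain ⟨q, hq, hq', hsum⟩ := this
    rw [← hq]
    refine hasCapMatching_of_le_sum q hq' _ ?_
    rw [hq, ← hsum, tsub_le_iff_left]
    exact add_le_add_left hle _
  · rintro ⟨M, hM, hMadj, hle⟩
    set B := n • Finset.univ.val - A with hB
    obtain ⟨r, hr⟩ := Multiset.le_iff_exists_add.mp hle
    have hcard : Multiset.card B = 2 * Multiset.card M + Multiset.card r := by
      rw [hr]; simp; ring
    -- Edges of the matching, singletons for the remaining demand, and empty sets as padding.
    obtain ⟨q, hq, hq', hsum⟩ : ∃ q : Multiset (Finset V), Multiset.card q = n ∧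
        (∀ I ∈ q, G.IsVertexCover ((Iᶜ : Finset V) : Set V)) ∧ (q.map Finset.val).sum = B := by
      refine ⟨M.map (fun e => {e.1, e.2}) + r.map (fun v => {v}) +
        Multiset.replicate (n - Multiset.card M - Multiset.card r) ∅, ?_, ?_, ?_⟩
      · simp only [Multiset.card_add, Multiset.card_map, Multiset.card_replicate]
        omega
      · intro I hI
        rw [isVertexCover_iff_compl_of_indepNum_le_two hG, compl_compl]
        simp only [Multiset.mem_add, Multiset.mem_map] at hI
        rcases hI with (⟨e, he, rfl⟩ | ⟨v, -, rfl⟩) | hI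
        · refine Or.inr (Or.inr ⟨_, _, hMadj e he, ?_⟩)
          rw [Finset.insert_val_of_notMem (by simpa using (hMadj e he).ne)]; rfl
        · exact Or.inr (Or.inl ⟨v, rfl⟩)
        · rw [Multiset.eq_of_mem_replicate hI]
          exact Or.inl rfl
      · have h1 : (M.map fun e => ({e.1, e.2} : Finset V).val) =
            M.map fun e => {e.1} + {e.2} := by
          refine Multiset.map_congr rfl fun e he => ?_
          rw [Finset.insert_val_of_notMem (by simpa using (hMadj e he).ne)]; rfl
        simp only [Multiset.map_add, Multiset.map_map, Multiset.sum_add, Function.comp_def, h1,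
          Multiset.sum_map_add, Multiset.map_replicate, Finset.empty_val, Multiset.sum_replicate,
          smul_zero, add_zero, Finset.singleton_val, Multiset.sum_map_singleton_apply, Multiset.sum_map_singleton, hr]
    have htotal : (q.map fun I => Iᶜ.val).sum + B = n • Finset.univ.val := by
      rw [← hsum, ← Multiset.sum_map_add, ← hq]
      simp only [add_comm, hcompl]
      simp
    refine ⟨q.map fun I => Iᶜ.val, by simpa using hq, ?_, ?_⟩
    · intro e he
      obtain ⟨I, hI, rfl⟩ := Multiset.mem_map.mp he
      exact ⟨_, hq' I hI, rfl⟩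
    · have : (q.map fun I => Iᶜ.val).sum + B ≤ A + B := by
        rw [htotal, hB]
        exact le_add_tsub
      exact le_of_add_le_add_right this

theorem isNormalIdeal_coverIdeal_iff_edgeIdeal_compl [Finite V] (K : Type*) [Field K]
    {G : SimpleGraph V} (hG : G.indepNum ≤ 2) :
    (G.coverIdeal K).IsNormalIdeal ↔ (Gᶜ.edgeIdeal K).IsNormalIdeal := by
  classical
  have := Fintype.ofFinite V
  rw [isNormalIdeal_coverIdeal_iff, isNormalIdeal_edgeIdeal_iff]
  simp only [dominatesSum_coverExponents_iff hG]
  have hsmul : ∀ (n k : ℕ) (A : Multiset V), (k * n) • Finset.univ.val - k • A =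
      k • (n • Finset.univ.val - A) := by
    intro n k A
    ext v
    simp only [Multiset.count_sub, Multiset.count_nsmul]
    rw [mul_assoc, Nat.mul_sub]
  have hcard : ∀ (n k : ℕ) (B : Multiset V), Multiset.card (k • B) - k * n =
      k * (Multiset.card B - n) := by
    intro n k B
    rw [Multiset.card_nsmul, Nat.mul_sub]
  constructor
  · intro h m hm B k hk hM
    -- Every edge of the fractional matching has an end other than `v`.
    have hcount : ∀ v, B.count v + m ≤ Multiset.card B := by
      intro v
      obtain ⟨M, hMc, hMadj, hle⟩ := hM
      have h1 := Multiset.countP_le_of_le (fun x => x ≠ v) hle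
      have h2 : ∀ N : Multiset V, N.countP (fun x => x ≠ v) + N.count v = Multiset.card N := by
        intro N
        rw [Multiset.card_eq_countP_add_countP (fun x => x ≠ v) N]
        simp [Multiset.count, eq_comm]
      have h3 : Multiset.card M ≤ (M.map Prod.fst + M.map Prod.snd).countP (fun x => x ≠ v) := by
        rw [Multiset.countP_add, Multiset.countP_map, Multiset.countP_map]
        rw [Multiset.card_eq_countP_add_countP (fun e => e.1 ≠ v) M,
          Multiset.countP_eq_card_filter, Multiset.countP_eq_card_filter]
        refine Nat.add_le_add_left (Multiset.card_le_card (Multiset.le_filter.mpr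
          ⟨Multiset.filter_le _ _, fun e he => ?_⟩)) _
        obtain ⟨heM, he⟩ := Multiset.mem_filter.mp he
        exact fun h => (hMadj e heM).ne ((not_not.mp he).trans h.symm)
      have h4 := h2 (k • B)
      rw [Multiset.count_nsmul, Multiset.card_nsmul] at h4
      have h5 : k * (B.count v + m) ≤ k * Multiset.card B := by
        rw [mul_add]; omega
      exact Nat.le_of_mul_le_mul_left h5 hk
    have h2m : k * (2 * m) ≤ k * Multiset.card B := by
      obtain ⟨M, hMc, -, hle⟩ := hM
      have := Multiset.card_le_card hle
      simp only [Multiset.card_add, Multiset.card_map, Multiset.card_nsmul] at this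
      linarith
    have h2m := Nat.le_of_mul_le_mul_left h2m hk
    have hB : (Multiset.card B - m) • Finset.univ.val -
        ((Multiset.card B - m) • Finset.univ.val - B) = B := by
      refine tsub_tsub_cancel_of_le ?_
      rw [Multiset.le_iff_count]
      intro v
      rw [Multiset.count_nsmul, Multiset.count_eq_one_of_mem Finset.univ.nodup (by simp)]
      have := hcount v
      omega
    have := h (Multiset.card B - m) (by omega)
      ((Multiset.card B - m) • Finset.univ.val - B) k hk
    rw [hsmul, hB, hcard, show Multiset.card B - (Multiset.card B - m) = m by omega] at this
    exact this hM
  · intro h n hn A k hk hM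
    rw [hsmul, hcard] at hM
    rcases Nat.eq_zero_or_pos (Multiset.card (n • Finset.univ.val - A) - n) with h0 | hpos
    · rw [h0]
      exact HasCapMatching.zero _
    · exact h _ hpos _ k hk hM

end SimpleGraph

/-! ### Chordless odd cycles inside odd closed walks -/

namespace SimpleGraph

variable {V : Type*} {H : SimpleGraph V}

theorem Walk.exists_closed_subwalk_of_not_isPath {u v : V} (p : H.Walk u v) (hp : ¬ p.IsPath) :
    ∃ (x : V) (a : H.Walk u x) (b : H.Walk x x) (c : H.Walk x v),
      p = a.append (b.append c) ∧ 0 < b.length := by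
  classical
  induction p with
  | nil => simp at hp
  | @cons u w v h p ih =>
    by_cases hp' : p.IsPath
    · have hu : u ∈ p.support := by
        by_contra hu
        exact hp ((Walk.cons_isPath_iff h p).mpr ⟨hp', hu⟩)
      exact ⟨u, Walk.nil, Walk.cons h (p.takeUntil u hu), p.dropUntil u hu, by simp, by simp⟩
    · obtain ⟨x, a, b, c, rfl, hb⟩ := ih hp'
      exact ⟨x, Walk.cons h a, b, c, rfl, hb⟩

theorem Walk.exists_eq_append_append_of_mem_support {u v x y : V} (p : H.Walk u v)
    (hx : x ∈ p.support) (hy : y ∈ p.support) :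
    (∃ (a : H.Walk u x) (b : H.Walk x y) (c : H.Walk y v), p = a.append (b.append c)) ∨
      ∃ (a : H.Walk u y) (b : H.Walk y x) (c : H.Walk x v), p = a.append (b.append c) := by
  classical
  rw [← p.take_spec hx, Walk.mem_support_append_iff] at hy
  rcases hy with hy | hy
  · refine Or.inr ⟨(p.takeUntil x hx).takeUntil y hy, (p.takeUntil x hx).dropUntil y hy,
      p.dropUntil x hx, ?_⟩
    rw [Walk.append_assoc, Walk.take_spec, Walk.take_spec]
  · refine Or.inl ⟨p.takeUntil x hx, (p.dropUntil x hx).takeUntil y hy,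
      (p.dropUntil x hx).dropUntil y hy, ?_⟩
    rw [Walk.take_spec, Walk.take_spec]

/-- A chord of a closed walk of odd length cuts off a shorter closed walk of odd length. -/
theorem Walk.exists_shorter_odd_of_chord {u x y : V} (a : H.Walk u x) (b : H.Walk x y)
    (c : H.Walk y u) (h : H.Adj x y) (hodd : Odd (a.append (b.append c)).length)
    (he : s(x, y) ∉ (a.append (b.append c)).edges) :
    ∃ (v : V) (q : H.Walk v v), Odd q.length ∧
      q.length < (a.append (b.append c)).length ∧ q.support ⊆ (a.append (b.append c)).support := by
  simp only [Walk.edges_append, List.mem_append, not_or, Walk.length_append] at he hodd ⊢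
  have hac : 2 ≤ a.length + c.length := by
    by_contra! hlt
    rcases a with _ | ⟨ha, a⟩
    · rcases c with _ | ⟨hc, c⟩
      · exact h.ne rfl
      · rcases c with _ | ⟨hc', c⟩
        · exact he.2.2 (by simp [Sym2.eq_swap])
        · simp at hlt
    · rcases a with _ | ⟨ha', a⟩
      · rcases c with _ | ⟨hc, c⟩
        · exact he.1 (by simp [Sym2.eq_swap])
        · simp at hlt
      · simp only [Walk.length_cons] at hlt; omega
  have hb : 2 ≤ b.length := by
    by_contra! hlt
    rcases b with _ | ⟨hb, b⟩
    · exact h.ne rfl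
    · rcases b with _ | ⟨hb', b⟩
      · exact he.2.1 (by simp)
      · simp at hlt
  rcases Nat.even_or_odd b.length with hb' | hb'
  · refine ⟨x, b.append (Walk.cons h.symm Walk.nil), ?_, ?_, ?_⟩
    · simpa using hb'.add_one
    · simp only [Walk.length_append, Walk.length_cons, Walk.length_nil]; omega
    · intro z hz
      simp only [Walk.mem_support_append_iff, Walk.support_cons, Walk.support_nil, List.mem_cons,
        List.not_mem_nil, or_false] at hz ⊢
      rcases hz with hz | rfl | rfl
      · exact Or.inr (Or.inl hz)
      · exact Or.inr (Or.inl b.end_mem_support)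
      · exact Or.inl a.end_mem_support
  · refine ⟨u, a.append (Walk.cons h c), ?_, ?_, ?_⟩
    · simp only [Walk.length_append, Walk.length_cons]
      rw [Nat.odd_iff] at *
      omega
    · simp only [Walk.length_append, Walk.length_cons]; omega
    · intro z hz
      simp only [Walk.mem_support_append_iff, Walk.support_cons, List.mem_cons] at hz ⊢
      rcases hz with hz | rfl | hz
      · exact Or.inl hz
      · exact Or.inl a.end_mem_support
      · exact Or.inr (Or.inr hz)

theorem Walk.exists_chordless_odd_cycle {u : V} (p : H.Walk u u) (hp : Odd p.length) :
    ∃ (v : V) (q : H.Walk v v), q.IsCycle ∧ q.IsChordless ∧ Odd q.length ∧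
      q.support ⊆ p.support := by
  induction hN : p.length using Nat.strong_induction_on generalizing u p with
  | _ N ih =>
    subst hN
    have descend : ∀ (v : V) (q : H.Walk v v), Odd q.length → q.length < p.length →
        q.support ⊆ p.support → ∃ (v : V) (q : H.Walk v v), q.IsCycle ∧ q.IsChordless ∧
          Odd q.length ∧ q.support ⊆ p.support := by
      intro v q h1 h2 h3
      obtain ⟨w, r, h4, h5, h6, h7⟩ := ih _ h2 q h1 rfl
      exact ⟨w, r, h4, h5, h6, fun z hz => h3 (h7 hz)⟩
    rcases p with _ | ⟨h, p⟩
    · simp at hp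
    by_cases hpath : p.IsPath
    · have hcycle : (Walk.cons h p).IsCycle := by
        rw [Walk.isCycle_iff_isPath_tail_and_le_length]
        refine ⟨by simpa using hpath, ?_⟩
        rcases p with _ | ⟨h', p⟩
        · exact absurd rfl h.ne
        · rcases p with _ | ⟨h'', p⟩
          · simp [Nat.odd_iff] at hp
          · simp
      by_cases hch : (Walk.cons h p).IsChordless
      · exact ⟨_, _, hcycle, hch, hp, fun z hz => hz⟩
      · rw [Walk.isChordless_iff_forall_mem_edges] at hch
        push Not at hch
        obtain ⟨x, y, hx, hy, hxy, he⟩ := hch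
        generalize Walk.cons h p = w at *
        rcases w.exists_eq_append_append_of_mem_support hx hy with
          ⟨a, b, c, rfl⟩ | ⟨a, b, c, rfl⟩
        · obtain ⟨v, q, h1, h2, h3⟩ := Walk.exists_shorter_odd_of_chord a b c hxy hp he
          exact descend v q h1 h2 h3
        · obtain ⟨v, q, h1, h2, h3⟩ := Walk.exists_shorter_odd_of_chord a b c hxy.symm hp
            (by rwa [Sym2.eq_swap])
          exact descend v q h1 h2 h3
    · obtain ⟨x, a, b, c, rfl, hb⟩ := p.exists_closed_subwalk_of_not_isPath hpath
      simp only [Walk.length_cons, Walk.length_append] at hp descend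
      rcases Nat.even_or_odd b.length with hb' | hb'
      · refine descend _ ((Walk.cons h a).append c) ?_ ?_ ?_
        · simp only [Walk.length_cons, Walk.length_append]
          rw [Nat.odd_iff] at *
          rw [Nat.even_iff] at hb'
          omega
        · simp only [Walk.length_cons, Walk.length_append]
          omega
        · intro z hz
          simp only [Walk.mem_support_append_iff, Walk.support_cons, List.mem_cons] at hz ⊢
          tauto
      · refine descend _ b hb' (by omega) ?_
        intro z hz
        simp only [Walk.mem_support_append_iff, Walk.support_cons, List.mem_cons]
        tauto

/-! ### Closed sequences of vertices -/

theorem exists_walk_of_forall_adj {f : ℕ → V} (hf : ∀ i, H.Adj (f i) (f (i + 1))) (n : ℕ) :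
    ∃ p : H.Walk (f 0) (f n), p.length = n ∧ ∀ z ∈ p.support, z ∈ Set.range f := by
  induction n with
  | zero => exact ⟨Walk.nil, rfl, by simp⟩
  | succ n ih =>
    obtain ⟨p, hp, hs⟩ := ih
    refine ⟨p.append (Walk.cons (hf n) Walk.nil), by simp [hp], ?_⟩
    intro z hz
    simp only [Walk.mem_support_append_iff, Walk.support_cons, Walk.support_nil, List.mem_cons,
      List.not_mem_nil, or_false] at hz
    rcases hz with hz | rfl | rfl
    exacts [hs z hz, ⟨n, rfl⟩, ⟨n + 1, rfl⟩]

/-- Without Hochster configurations, any two odd closed sequences of adjacent vertices are joined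
by an edge. -/
theorem exists_adj_of_not_hasHochsterConfiguration (hH : ¬ H.HasHochsterConfiguration)
    {f g : ℕ → V} (hf : ∀ i, H.Adj (f i) (f (i + 1))) (hg : ∀ i, H.Adj (g i) (g (i + 1)))
    {k l : ℕ} (hk : Odd k) (hl : Odd l) (hfk : f k = f 0) (hgl : g l = g 0) :
    ∃ i j, H.Adj (f i) (g j) := by
  by_contra! hno
  obtain ⟨p, hp, hps⟩ := exists_walk_of_forall_adj hf k
  obtain ⟨q, hq, hqs⟩ := exists_walk_of_forall_adj hg l
  obtain ⟨u, p', hp1, hp2, hp3, hp4⟩ :=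
    (p.copy rfl hfk).exists_chordless_odd_cycle (by simpa [hp] using hk)
  obtain ⟨v, q', hq1, hq2, hq3, hq4⟩ :=
    (q.copy rfl hgl).exists_chordless_odd_cycle (by simpa [hq] using hl)
  refine hH ⟨u, v, p', q', hp1, hq1, hp3, hq3, ?_, hp2, hq2⟩
  rw [Set.eq_empty_iff_forall_notMem]
  rintro w ⟨hw, x, hx, hxw⟩
  obtain ⟨i, rfl⟩ := hps w (by simpa using hp4 hw)
  obtain ⟨j, rfl⟩ := hqs x (by simpa using hq4 hx)
  exact hno i j hxw.symm

theorem map_range_add_of_periodic {f : ℕ → V} {l : ℕ} (hf : ∀ i, f (i + l) = f i) (j : ℕ) :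
    (Multiset.range l).map (fun i => f (i + j)) = (Multiset.range l).map f := by
  induction j with
  | zero => rfl
  | succ j ih =>
    rw [← ih]
    have h1 : (Multiset.range (l + 1)).map (fun i => f (i + j)) =
        f j ::ₘ (Multiset.range l).map (fun i => f (i + j)) := by
      rw [Multiset.range_succ, Multiset.map_cons, add_comm l j, hf]
    have h2 : (Multiset.range (l + 1)).map (fun i => f (i + j)) =
        f j ::ₘ (Multiset.range l).map (fun i => f (i + (j + 1))) := by
      have h3 : Multiset.range (l + 1) = 0 ::ₘ (Multiset.range l).map Nat.succ :=
        congrArg _ (List.range_succ_eq_map (n := l))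
      rw [h3, Multiset.map_cons, Multiset.map_map, zero_add]
      congr 2
      funext i
      simp [add_assoc, add_comm 1 j]
    rw [h1] at h2
    exact ((Multiset.cons_inj_right _).mp h2).symm

theorem hasCapMatching_map_range {f : ℕ → V} (hf : ∀ i, H.Adj (f i) (f (i + 1))) (m : ℕ) :
    H.HasCapMatching m ((Multiset.range (2 * m)).map f) := by
  induction m with
  | zero => exact HasCapMatching.zero _
  | succ m ih =>
    have := ih.add (HasCapMatching.pair (hf (2 * m)))
    refine this.mono le_rfl (le_of_eq ?_)
    rw [show 2 * (m + 1) = 2 * m + 1 + 1 by ring, Multiset.range_succ, Multiset.range_succ,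
      Multiset.map_cons, Multiset.map_cons, add_comm, Multiset.insert_eq_cons, Multiset.cons_add,
      Multiset.singleton_add, Multiset.cons_swap]

/-- An odd closed sequence is perfectly matched after the removal of any of its vertices. -/
theorem exists_hasCapMatching_of_odd {f : ℕ → V} (hf : ∀ i, H.Adj (f i) (f (i + 1))) {m : ℕ}
    (hper : ∀ i, f (i + (2 * m + 1)) = f i) (j : ℕ) :
    ∃ R, (Multiset.range (2 * m + 1)).map f = f j ::ₘ R ∧ H.HasCapMatching m R := by
  refine ⟨(Multiset.range (2 * m)).map (fun i => f (i + (j + 1))), ?_,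
    hasCapMatching_map_range (fun i => ?_) m⟩
  · rw [← map_range_add_of_periodic hper (j + 1), Multiset.range_succ, Multiset.map_cons]
    congr 1
    rw [← hper j]
    congr 1
    ring
  · rw [show i + 1 + (j + 1) = i + (j + 1) + 1 by ring]
    exact hf _

/-- A nonempty balanced arc multiset on a finite vertex set contains a simple directed cycle,
given as a periodic sequence. -/
theorem exists_periodic_le_of_balanced [Finite V] {D : Multiset (V × V)} (hD : D ≠ 0)
    (hbal : D.map Prod.fst = D.map Prod.snd) :
    ∃ (f : ℕ → V) (l : ℕ), 0 < l ∧ (∀ i, f (i + l) = f i) ∧ (∀ i, (f i, f (i + 1)) ∈ D) ∧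
      (Multiset.range l).map (fun i => (f i, f (i + 1))) ≤ D := by
  classical
  obtain ⟨⟨a, b⟩, hab⟩ := Multiset.exists_mem_of_ne_zero hD
  have hnext : ∀ v, ∃ w, v ∈ D.map Prod.fst → (v, w) ∈ D := by
    intro v
    by_cases hv : v ∈ D.map Prod.fst
    · obtain ⟨⟨v', w⟩, h, rfl⟩ := Multiset.mem_map.mp hv
      exact ⟨w, fun _ => h⟩
    · exact ⟨v, fun h => absurd h hv⟩
  choose next hnext using hnext
  have hmem : ∀ i, next^[i] a ∈ D.map Prod.fst := by
    intro i
    induction i with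
    | zero => exact Multiset.mem_map_of_mem Prod.fst hab
    | succ i ih =>
      rw [Function.iterate_succ_apply', hbal]
      exact Multiset.mem_map_of_mem Prod.snd (hnext _ ih)
  obtain ⟨i, j, hij, heq⟩ := Finite.exists_ne_map_eq_of_infinite fun i => next^[i] a
  wlog hlt : i < j generalizing i j
  · exact this j i hij.symm heq.symm (by omega)
  obtain ⟨k, rfl⟩ := Nat.exists_eq_add_of_lt hlt
  set x := next^[i] a with hx
  have hper : Function.IsPeriodicPt next (k + 1) x := by
    rw [Function.IsPeriodicPt, Function.IsFixedPt, hx, ← Function.iterate_add_apply,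
      show k + 1 + i = i + k + 1 by ring]
    exact heq.symm
  have hxmem : ∀ i, next^[i] x ∈ D.map Prod.fst := by
    intro i'
    rw [hx, ← Function.iterate_add_apply]
    exact hmem _
  have harc : ∀ i, (next^[i] x, next^[i + 1] x) ∈ D := by
    intro i
    rw [Function.iterate_succ_apply']
    exact hnext _ (hxmem i)
  refine ⟨fun i => next^[i] x, Function.minimalPeriod next x, hper.minimalPeriod_pos (by omega),
    ?_, harc, ?_⟩
  · intro i
    dsimp only
    rw [Function.iterate_add_apply, Function.iterate_minimalPeriod]
  · rw [Multiset.le_iff_subset]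
    · intro e he
      obtain ⟨i, -, rfl⟩ := Multiset.mem_map.mp he
      exact harc i
    · refine Multiset.Nodup.map_on ?_ (Multiset.nodup_range _)
      intro i hi j hj h
      exact Function.iterate_injOn_Iio_minimalPeriod (Multiset.mem_range.mp hi)
        (Multiset.mem_range.mp hj) (congrArg Prod.fst h)

end SimpleGraph

/-! ### From fractional to integral matchings -/

namespace SimpleGraph

variable {V : Type*} {H : SimpleGraph V}

/-- A matching of size `k * n` with capacities `k • A`, read as a fractional matching of size `n`
with capacities `A`, yields an integral set of `2 * n` arcs with in- and out-degrees bounded by `A`.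
This is Hall's theorem for the bipartite double cover of `H`, each side of which contains every
vertex as often as it occurs in `A`; dummy vertices on one side account for the deficiency. -/
theorem HasCapMatching.exists_arcs {k n : ℕ} (hk : 1 ≤ k) {A : Multiset V}
    (h : H.HasCapMatching (k * n) (k • A)) :
    ∃ D : Multiset (V × V), (∀ e ∈ D, H.Adj e.1 e.2) ∧ D.map Prod.fst ≤ A ∧ D.map Prod.snd ≤ A ∧
      2 * n ≤ Multiset.card D := by
  classical
  obtain ⟨N, hN, hadj, hle⟩ := h
  obtain ⟨m, g, rfl⟩ : ∃ (m : ℕ) (g : Fin m → V), A = Finset.univ.val.map g := by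
    induction A using Quotient.inductionOn with
    | _ l =>
      refine ⟨l.length, l.get, ?_⟩
      rw [Fin.univ_val_map, List.ofFn_get]
      rfl
  -- The fractional matching, with each edge listed in both directions.
  set S := N + N.map Prod.swap with hS
  have hSadj : ∀ e ∈ S, H.Adj e.1 e.2 := by
    intro e he
    rcases Multiset.mem_add.mp he with he | he
    · exact hadj e he
    · obtain ⟨a, ha, rfl⟩ := Multiset.mem_map.mp he
      exact (hadj a ha).symm
  have hfst : S.map Prod.fst ≤ k • Finset.univ.val.map g := by
    refine le_trans (le_of_eq ?_) hle
    rw [hS, Multiset.map_add, Multiset.map_map]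
    rfl
  have hsnd : S.map Prod.snd ≤ k • Finset.univ.val.map g := by
    refine le_trans (le_of_eq ?_) hle
    rw [hS, Multiset.map_add, Multiset.map_map, add_comm]
    rfl
  have hScard : Multiset.card S = k * (2 * n) := by
    rw [hS, Multiset.card_add, Multiset.card_map, hN]; ring
  have hcountP : ∀ P : V → Prop, (Finset.univ.val.map g).countP P =
      (Finset.univ.filter fun i => P (g i)).card := by
    intro P
    rw [Multiset.countP_map]
    rfl
  have hm : 2 * n ≤ m := by
    have := Multiset.card_le_card hfst
    rw [Multiset.card_map, hScard, Multiset.card_nsmul, Multiset.card_map] at this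
    have := Nat.le_of_mul_le_mul_left this hk
    simpa using this
  let t : Fin m → Finset (Fin m ⊕ Fin (m - 2 * n)) := fun i =>
    (Finset.univ.filter fun j => H.Adj (g i) (g j)).disjSum Finset.univ
  have hall : ∀ s : Finset (Fin m), s.card ≤ (s.biUnion t).card := by
    intro s
    rcases s.eq_empty_or_nonempty with rfl | ⟨i₀, hi₀⟩
    · simp
    obtain ⟨T, hT⟩ : ∃ T : V → Prop, ∀ v, T v ↔ ∃ i ∈ s, g i = v := ⟨_, fun _ => Iff.rfl⟩
    obtain ⟨NT, hNT⟩ : ∃ NT : V → Prop, ∀ v, NT v ↔ ∃ i ∈ s, H.Adj (g i) v :=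
      ⟨_, fun _ => Iff.rfl⟩
    have hbi : s.biUnion t = (Finset.univ.filter fun j => NT (g j)).disjSum Finset.univ := by
      ext x
      rcases x with j | r
      · simp [t, hNT]
      · simpa [t] using ⟨i₀, hi₀⟩
    rw [hbi, Finset.card_disjSum, Finset.card_univ, Fintype.card_fin, ← hcountP]
    have h1 : s.card ≤ (Finset.univ.val.map g).countP T := by
      rw [hcountP]
      refine Finset.card_le_card fun i hi => ?_
      exact Finset.mem_filter.mpr ⟨Finset.mem_univ i, (hT _).mpr ⟨i, hi, rfl⟩⟩
    have h3 : S.countP (fun e => T e.1) ≤ S.countP (fun e => NT e.2) := by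
      rw [Multiset.countP_eq_card_filter, Multiset.countP_eq_card_filter]
      refine Multiset.card_le_card (Multiset.le_filter.mpr ⟨Multiset.filter_le _ _, fun e he => ?_⟩)
      obtain ⟨heS, he⟩ := Multiset.mem_filter.mp he
      obtain ⟨i, hi, hgi⟩ := (hT _).mp he
      exact (hNT _).mpr ⟨i, hi, hgi ▸ hSadj e heS⟩
    have h4 : S.countP (fun e => NT e.2) ≤ k * (Finset.univ.val.map g).countP NT := by
      have := Multiset.countP_le_of_le NT hsnd
      rwa [Multiset.countP_map, ← Multiset.countP_eq_card_filter, Multiset.countP_nsmul] at this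
    have h5 : S.countP (fun e => ¬ T e.1) ≤
        k * (Finset.univ.val.map g).countP (fun v => ¬ T v) := by
      have := Multiset.countP_le_of_le (fun v => ¬ T v) hfst
      rwa [Multiset.countP_map, ← Multiset.countP_eq_card_filter, Multiset.countP_nsmul] at this
    have h6 := Multiset.card_eq_countP_add_countP (fun e : V × V => T e.1) S
    have h7 := Multiset.card_eq_countP_add_countP T (Finset.univ.val.map g)
    have h7' : Multiset.card (Finset.univ.val.map g) = m := by simp
    have h8 : k * (2 * n) ≤ k * ((Finset.univ.val.map g).countP NT +
        (Finset.univ.val.map g).countP (fun v => ¬ T v)) := by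
      rw [mul_add, ← hScard]; omega
    have h9 := Nat.le_of_mul_le_mul_left h8 hk
    omega
  obtain ⟨φ, hφ, hφt⟩ := (Finset.all_card_le_biUnion_card_iff_exists_injective t).mp hall
  let P : Finset (Fin m × Fin m) := Finset.univ.filter fun p => φ p.1 = Sum.inl p.2
  have hP : ∀ p ∈ P, φ p.1 = Sum.inl p.2 := fun p hp => (Finset.mem_filter.mp hp).2
  have hsub : ∀ π : Fin m × Fin m → Fin m, Set.InjOn π P →
      P.val.map (fun p => g (π p)) ≤ Finset.univ.val.map g := by
    intro π hπ
    change P.val.map (g ∘ π) ≤ _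
    rw [← Multiset.map_map g π]
    refine Multiset.map_le_map ((Multiset.le_iff_subset ?_).mpr fun i _ => Finset.mem_univ i)
    exact Multiset.Nodup.map_on (fun p hp q hq h => hπ hp hq h) P.nodup
  refine ⟨P.val.map fun p => (g p.1, g p.2), ?_, ?_, ?_, ?_⟩
  · intro e he
    obtain ⟨p, hp, rfl⟩ := Multiset.mem_map.mp he
    have := hφt p.1
    rw [hP p hp] at this
    simpa [t] using this
  · rw [Multiset.map_map]
    refine hsub Prod.fst fun p hp q hq h => Prod.ext h ?_
    have := hP q hq
    rw [← h, hP p hp] at this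
    exact Sum.inl_injective this
  · rw [Multiset.map_map]
    refine hsub Prod.snd fun p hp q hq h => Prod.ext (hφ ?_) h
    rw [hP p hp, hP q hq, h]
  · rw [Multiset.card_map, Finset.card_val]
    have h1 : (Finset.univ.filter fun i => ¬ ∃ j, φ i = Sum.inl j).card ≤ m - 2 * n := by
      have : (Finset.univ.filter fun i => ¬ ∃ j, φ i = Sum.inl j).image φ ⊆
          (Finset.univ : Finset (Fin (m - 2 * n))).image Sum.inr := by
        intro x hx
        obtain ⟨i, hi, rfl⟩ := Finset.mem_image.mp hx
        rcases hφi : φ i with j | r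
        · exact absurd ⟨j, hφi⟩ (Finset.mem_filter.mp hi).2
        · exact Finset.mem_image_of_mem _ (Finset.mem_univ _)
      have := (Finset.card_le_card this).trans Finset.card_image_le
      rwa [Finset.card_image_of_injective _ hφ, Finset.card_univ, Fintype.card_fin] at this
    have h2 : (Finset.univ.filter fun i => ∃ j, φ i = Sum.inl j).card ≤ P.card := by
      refine (Finset.card_le_card ?_).trans (Finset.card_image_le (s := P) (f := Prod.fst))
      intro i hi
      obtain ⟨j, hj⟩ := (Finset.mem_filter.mp hi).2
      exact Finset.mem_image.mpr ⟨(i, j), by simpa [P] using hj, rfl⟩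
    have h3 := Finset.card_filter_add_card_filter_not (s := (Finset.univ : Finset (Fin m)))
      (fun i => ∃ j, φ i = Sum.inl j)
    rw [Finset.card_univ, Fintype.card_fin] at h3
    omega

/-- If `u` is the tail of an arc of `D` but has spare capacity for incoming arcs, then an arc
`u → v` may be used as an edge of the matching: this costs at most that arc and one arc leaving
`v`. -/
theorem exists_edge_of_count_lt [DecidableEq V] {D : Multiset (V × V)} {A : Multiset V}
    (hadj : ∀ e ∈ D, H.Adj e.1 e.2) (hfst : D.map Prod.fst ≤ A) (hsnd : D.map Prod.snd ≤ A)
    {u : V} (hu : u ∈ D.map Prod.fst) (hlt : (D.map Prod.snd).count u < A.count u) :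
    ∃ (D' : Multiset (V × V)) (A' : Multiset V) (v : V), H.Adj u v ∧ D' < D ∧
      Multiset.card D ≤ Multiset.card D' + 2 ∧ {u, v} + A' = A ∧ D'.map Prod.fst ≤ A' ∧
      D'.map Prod.snd ≤ A' := by
  obtain ⟨⟨u', v⟩, huv, rfl⟩ := Multiset.mem_map.mp hu
  dsimp only at hu hlt ⊢
  obtain ⟨D₁, rfl⟩ := Multiset.exists_cons_of_mem huv
  have hne : u' ≠ v := (hadj _ huv).ne
  rw [Multiset.map_cons] at hfst hsnd hlt
  obtain ⟨A₁, rfl⟩ := Multiset.exists_cons_of_mem (a := u') (Multiset.mem_of_le hfst (by simp))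
  have hv : v ∈ A₁ := by
    have : v ∈ u' ::ₘ A₁ := Multiset.mem_of_le hsnd (by simp)
    exact (Multiset.mem_cons.mp this).resolve_left hne.symm
  obtain ⟨A', rfl⟩ := Multiset.exists_cons_of_mem hv
  obtain ⟨D₂, hD₂, hcard, hD₂fst⟩ : ∃ D₂ ≤ D₁, Multiset.card D₁ ≤ Multiset.card D₂ + 1 ∧
      D₂.map Prod.fst = (D₁.map Prod.fst).erase v := by
    by_cases hvD : v ∈ D₁.map Prod.fst
    · obtain ⟨e, he, rfl⟩ := Multiset.mem_map.mp hvD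
      obtain ⟨D₂, rfl⟩ := Multiset.exists_cons_of_mem he
      exact ⟨D₂, Multiset.le_cons_self _ _, by simp, by simp⟩
    · exact ⟨D₁, le_rfl, by simp, (Multiset.erase_of_notMem hvD).symm⟩
  refine ⟨D₂, A', v, hadj _ huv, lt_of_le_of_lt hD₂ (Multiset.lt_cons_self _ _), ?_, ?_, ?_, ?_⟩
  · rw [Multiset.card_cons]; omega
  · simp
  · rw [hD₂fst]
    exact Multiset.erase_le_iff_le_cons.mpr ((Multiset.cons_le_cons_iff _).mp hfst)
  · refine (Multiset.map_le_map hD₂).trans (Multiset.le_iff_count.mpr fun x => ?_)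
    have h1 := Multiset.le_iff_count.mp hsnd x
    dsimp only at h1 hlt
    by_cases hx : x = u'
    · subst hx
      simp only [Multiset.count_cons_self, Multiset.count_cons_of_ne hne] at hlt
      omega
    · rw [Multiset.count_cons_of_ne hx] at h1
      by_cases hxv : x = v
      · subst hxv
        simpa using h1
      · simpa only [Multiset.count_cons_of_ne hxv] using h1

theorem map_range_arc_fst (f : ℕ → V) (l : ℕ) :
    ((Multiset.range l).map fun i => (f i, f (i + 1))).map Prod.fst = (Multiset.range l).map f := by
  rw [Multiset.map_map]
  rfl

theorem map_range_arc_snd {f : ℕ → V} {l : ℕ} (hf : ∀ i, f (i + l) = f i) :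
    ((Multiset.range l).map fun i => (f i, f (i + 1))).map Prod.snd = (Multiset.range l).map f := by
  rw [Multiset.map_map, ← map_range_add_of_periodic hf 1]
  rfl

/-- An arc multiset whose in- and out-degrees are bounded by `A` contains a matching of half its
size, provided that there is no Hochster configuration. Unbalanced vertices are treated by
`exists_edge_of_count_lt`. A balanced arc multiset decomposes into directed cycles; the even ones
are perfectly matched, and two odd ones are perfectly matched with the help of an edge joining
them. At most one odd cycle remains, and it contributes all but half an edge. -/
theorem hasCapMatching_of_arcs [Finite V] (hH : ¬ H.HasHochsterConfiguration)
    (D : Multiset (V × V)) (hadj : ∀ e ∈ D, H.Adj e.1 e.2) {A : Multiset V}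
    (hfst : D.map Prod.fst ≤ A) (hsnd : D.map Prod.snd ≤ A) {n : ℕ}
    (hn : 2 * n ≤ Multiset.card D) : H.HasCapMatching n A := by
  classical
  induction hN : Multiset.card D using Nat.strong_induction_on generalizing D A n with
  | _ N ih =>
    subst hN
    rcases Nat.eq_zero_or_pos n with rfl | hnpos
    · exact HasCapMatching.zero A
    by_cases hout : ∃ u ∈ D.map Prod.fst, (D.map Prod.snd).count u < A.count u
    · obtain ⟨u, hu, hlt⟩ := hout
      obtain ⟨D', A', v, huv, hD', hcard, rfl, h1, h2⟩ :=
        exists_edge_of_count_lt hadj hfst hsnd hu hlt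
      have := ih _ (Multiset.card_lt_card hD') D'
        (fun e he => hadj e (Multiset.mem_of_le hD'.le he)) h1 h2 (n := n - 1) (by omega) rfl
      exact ((HasCapMatching.pair huv).add this).mono (by omega) le_rfl
    by_cases hin : ∃ u ∈ D.map Prod.snd, (D.map Prod.fst).count u < A.count u
    · -- The previous case with all arcs reversed.
      obtain ⟨u, hu, hlt⟩ := hin
      have hs1 : (D.map Prod.swap).map Prod.fst = D.map Prod.snd := by
        rw [Multiset.map_map]; rfl
      have hs2 : (D.map Prod.swap).map Prod.snd = D.map Prod.fst := by
        rw [Multiset.map_map]; rfl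
      have hs3 : ∀ e ∈ D.map Prod.swap, H.Adj e.1 e.2 := by
        intro e he
        obtain ⟨a, ha, rfl⟩ := Multiset.mem_map.mp he
        exact (hadj a ha).symm
      obtain ⟨D', A', v, huv, hD', hcard, rfl, h1, h2⟩ :=
        exists_edge_of_count_lt hs3 (hs1 ▸ hsnd) (hs2 ▸ hfst) (hs1 ▸ hu) (hs2 ▸ hlt)
      have hlt' := Multiset.card_lt_card hD'
      rw [Multiset.card_map] at hlt' hcard
      have := ih _ hlt' D'
        (fun e he => hs3 e (Multiset.mem_of_le hD'.le he)) h1 h2 (n := n - 1) (by omega) rfl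
      exact ((HasCapMatching.pair huv).add this).mono (by omega) le_rfl
    push Not at hout hin
    have hbal : D.map Prod.fst = D.map Prod.snd := by
      ext u
      have h1 := Multiset.le_iff_count.mp hfst u
      have h2 := Multiset.le_iff_count.mp hsnd u
      have h3 := hout u
      have h4 := hin u
      rw [← Multiset.count_pos] at h3 h4
      omega
    -- A balanced part `E` of `D` whose vertices are perfectly matched can be split off.
    have split : ∀ (E D' : Multiset (V × V)) (p : ℕ), E + D' = D → 0 < Multiset.card E →
        Multiset.card E = 2 * p → E.map Prod.fst = E.map Prod.snd →
        H.HasCapMatching p (E.map Prod.fst) → H.HasCapMatching n A := by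
      intro E D' p hED hEpos hE hEbal hp
      have hcard : Multiset.card E + Multiset.card D' = Multiset.card D := by
        rw [← hED, Multiset.card_add]
      rw [← hED, Multiset.map_add] at hfst hsnd
      obtain ⟨A', rfl⟩ := Multiset.le_iff_exists_add.mp (le_of_add_le_left hfst)
      have := ih _ (by omega) D'
        (fun e he => hadj e (hED ▸ Multiset.mem_add.mpr (Or.inr he)))
        (le_of_add_le_add_left hfst) (by rw [← hEbal] at hsnd; exact le_of_add_le_add_left hsnd)
        (n := n - p) (by omega) rfl
      exact (hp.add this).mono (by omega) le_rfl
    have hD0 : D ≠ 0 := by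
      rintro rfl
      simp at hn
      omega
    obtain ⟨f, l, hl, hfper, hfD, hfle⟩ := exists_periodic_le_of_balanced hD0 hbal
    have hfadj : ∀ i, H.Adj (f i) (f (i + 1)) := fun i => hadj _ (hfD i)
    obtain ⟨D₁, hD₁⟩ := Multiset.le_iff_exists_add.mp hfle
    have hfbal := (map_range_arc_fst f l).trans (map_range_arc_snd hfper).symm
    rcases Nat.even_or_odd' l with ⟨p, rfl | rfl⟩
    · refine split _ D₁ p hD₁.symm (by simpa using hl) (by simp) hfbal ?_
      rw [map_range_arc_fst]
      exact hasCapMatching_map_range hfadj p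
    rcases eq_or_ne D₁ 0 with rfl | hD₁0
    · -- A single odd cycle, with `2 * p + 1 ≥ 2 * n` arcs.
      obtain ⟨R, hR, hRM⟩ := exists_hasCapMatching_of_odd hfadj hfper 0
      rw [add_zero] at hD₁
      refine hRM.mono ?_ ?_
      · rw [hD₁] at hn
        simp at hn
        omega
      · refine le_trans ?_ hfst
        rw [hD₁, map_range_arc_fst, hR]
        exact Multiset.le_cons_self _ _
    have hbal₁ : D₁.map Prod.fst = D₁.map Prod.snd := by
      rw [hD₁, Multiset.map_add, Multiset.map_add, hfbal] at hbal
      exact add_left_cancel hbal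
    obtain ⟨g, l', hl', hgper, hgD, hgle⟩ := exists_periodic_le_of_balanced hD₁0 hbal₁
    have hgadj : ∀ i, H.Adj (g i) (g (i + 1)) := fun i =>
      hadj _ (hD₁ ▸ Multiset.mem_add.mpr (Or.inr (hgD i)))
    obtain ⟨D₂, hD₂⟩ := Multiset.le_iff_exists_add.mp hgle
    have hgbal := (map_range_arc_fst g l').trans (map_range_arc_snd hgper).symm
    rcases Nat.even_or_odd' l' with ⟨q, rfl | rfl⟩
    · refine split _ ((Multiset.range (2 * p + 1)).map (fun i => (f i, f (i + 1))) + D₂) q ?_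
        (by simpa using hl') (by simp) hgbal ?_
      · rw [hD₁, hD₂]; abel
      · rw [map_range_arc_fst]
        exact hasCapMatching_map_range hgadj q
    -- Two odd cycles: remove a pair of adjacent vertices and match the remaining paths.
    obtain ⟨i, j, hij⟩ := exists_adj_of_not_hasHochsterConfiguration hH hfadj hgadj
      (odd_two_mul_add_one p) (odd_two_mul_add_one q)
      (by simpa using hfper 0) (by simpa using hgper 0)
    obtain ⟨R, hR, hRM⟩ := exists_hasCapMatching_of_odd hfadj hfper i
    obtain ⟨S, hS, hSM⟩ := exists_hasCapMatching_of_odd hgadj hgper j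
    refine split ((Multiset.range (2 * p + 1)).map (fun i => (f i, f (i + 1))) +
      (Multiset.range (2 * q + 1)).map (fun i => (g i, g (i + 1)))) D₂ (p + q + 1) ?_
      (by simp) ?_ ?_ ?_
    · rw [hD₁, hD₂, add_assoc]
    · simp only [Multiset.card_add, Multiset.card_map, Multiset.card_range]; ring
    · rw [Multiset.map_add, Multiset.map_add, hfbal, hgbal]
    · rw [Multiset.map_add, map_range_arc_fst, map_range_arc_fst, hR, hS]
      refine ((hRM.add hSM).add (HasCapMatching.pair hij)).mono le_rfl (le_of_eq ?_)
      simp only [Multiset.insert_eq_cons, ← Multiset.singleton_add]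
      abel

/-! ### Hochster configurations obstruct normality -/

theorem Walk.map_fst_darts_eq_map_snd_darts {u : V} (p : H.Walk u u) :
    (p.darts.map (fun d => d.toProd.1) : Multiset V) = p.darts.map (fun d => d.toProd.2) := by
  have h1 := p.map_fst_darts_append
  have h2 := p.cons_map_snd_darts
  have h3 : ((p.darts.map (fun d => d.toProd.1) : List V) : Multiset V) + {u} =
      ((p.darts.map (fun d => d.toProd.2) : List V) : Multiset V) + {u} := by
    rw [add_comm _ ({u} : Multiset V), add_comm _ ({u} : Multiset V), Multiset.singleton_add,
      Multiset.singleton_add, Multiset.cons_coe, Multiset.cons_coe, h2, ← h1]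
    exact Multiset.coe_eq_coe.mpr (List.perm_append_singleton _ _).symm
  exact add_right_cancel h3

/-- The arcs of the two cycles of a Hochster configuration form a fractional perfect matching of
its vertices, but an integral perfect matching would match each of the two odd vertex sets
within itself. -/
theorem not_hasHochsterConfiguration_of_forall_hasCapMatching
    (h : ∀ n, 1 ≤ n → ∀ (A : Multiset V) (k : ℕ), 1 ≤ k →
      H.HasCapMatching (k * n) (k • A) → H.HasCapMatching n A) :
    ¬ H.HasHochsterConfiguration := by
  classical
  rintro ⟨u, v, p, q, hp, -, hpodd, hqodd, hdisj, -, -⟩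
  have hno : ∀ x ∈ p.support, ∀ y ∈ q.support, ¬ H.Adj x y := by
    intro x hx y hy hxy
    have : x ∈ ({w | w ∈ p.support} ∩ H.neighborsOf {w | w ∈ q.support} : Set V) :=
      ⟨hx, y, hy, hxy.symm⟩
    rw [hdisj] at this
    exact this
  let F : Multiset V := (p.darts.map (fun d => d.toProd.1) : List V)
  let G : Multiset V := (q.darts.map (fun d => d.toProd.1) : List V)
  have hFmem : ∀ x ∈ F, x ∈ p.support := by
    intro x hx
    obtain ⟨d, hd, rfl⟩ := List.mem_map.mp (Multiset.mem_coe.mp hx)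
    exact p.dart_fst_mem_support_of_mem_darts hd
  have hGmem : ∀ x ∈ G, x ∈ q.support := by
    intro x hx
    obtain ⟨d, hd, rfl⟩ := List.mem_map.mp (Multiset.mem_coe.mp hx)
    exact q.dart_fst_mem_support_of_mem_darts hd
  -- A common vertex would be adjacent to its successor on the other cycle.
  have hGp : ∀ x ∈ G, x ∉ p.support := by
    intro x hx hxp
    obtain ⟨d, hd, rfl⟩ := List.mem_map.mp (Multiset.mem_coe.mp hx)
    exact hno _ hxp _ (q.dart_snd_mem_support_of_mem_darts hd) d.adj
  have hFcard : Multiset.card F = p.length := by simp [F]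
  have hGcard : Multiset.card G = q.length := by simp [G]
  obtain ⟨m, hm⟩ : ∃ m, p.length + q.length = 2 * m := by
    obtain ⟨m, hm⟩ := hpodd.add_odd hqodd
    exact ⟨m, by omega⟩
  have hfrac : H.HasCapMatching (2 * m) (2 • (F + G)) := by
    refine ⟨((p.darts.map (fun d => d.toProd) : List (V × V)) : Multiset (V × V)) +
      ((q.darts.map (fun d => d.toProd) : List (V × V)) : Multiset (V × V)), ?_, ?_, ?_⟩
    · simp [hm]
    · intro e he
      simp only [Multiset.mem_add, Multiset.mem_coe, List.mem_map] at he
      rcases he with ⟨d, -, rfl⟩ | ⟨d, -, rfl⟩ <;> exact d.adj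
    · refine le_of_eq ?_
      have h1 := p.map_fst_darts_eq_map_snd_darts
      have h2 := q.map_fst_darts_eq_map_snd_darts
      simp only [Multiset.map_add, Multiset.map_coe, List.map_map, Function.comp_def, two_nsmul]
      rw [← h1, ← h2]
  have hmpos : 1 ≤ m := by
    have := hpodd.pos
    omega
  obtain ⟨M, hMcard, hMadj, hMle⟩ := h m hmpos (F + G) 2 (by norm_num) hfrac
  have heq : M.map Prod.fst + M.map Prod.snd = F + G := by
    refine Multiset.eq_of_le_of_card_le hMle ?_
    simp only [Multiset.card_add, Multiset.card_map, hFcard, hGcard, hMcard]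
    omega
  have hends : ∀ e ∈ M, (e.1 ∈ p.support ↔ e.2 ∈ p.support) := by
    have hmem : ∀ x ∈ F + G, x ∈ p.support ∨ x ∈ q.support := fun x hx =>
      (Multiset.mem_add.mp hx).imp (hFmem x) (hGmem x)
    intro e he
    have h1 := hmem e.1 (heq ▸ Multiset.mem_add.mpr (Or.inl (Multiset.mem_map_of_mem _ he)))
    have h2 := hmem e.2 (heq ▸ Multiset.mem_add.mpr (Or.inr (Multiset.mem_map_of_mem _ he)))
    constructor
    · intro h
      exact h2.resolve_right fun h' => hno _ h _ h' (hMadj e he)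
    · intro h
      exact h1.resolve_right fun h' => hno _ h _ h' (hMadj e he).symm
  have hcount := congrArg (Multiset.countP fun x => x ∈ p.support) heq
  rw [Multiset.countP_add, Multiset.countP_add, Multiset.countP_eq_card.mpr hFmem,
    Multiset.countP_eq_zero.mpr hGp, Multiset.countP_map, Multiset.countP_map,
    Multiset.filter_congr hends, hFcard] at hcount
  rw [Nat.odd_iff] at hpodd
  omega

/-- The edge ideal of a finite graph is normal if and only if the graph has no Hochster
configuration (Simis, Vasconcelos and Villarreal). -/
theorem isNormalIdeal_edgeIdeal_iff_not_hasHochsterConfiguration [Finite V] (K : Type*) [Field K]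
    (H : SimpleGraph V) : (H.edgeIdeal K).IsNormalIdeal ↔ ¬ H.HasHochsterConfiguration := by
  rw [isNormalIdeal_edgeIdeal_iff]
  refine ⟨not_hasHochsterConfiguration_of_forall_hasCapMatching, fun hH n _ A k hk hM => ?_⟩
  obtain ⟨D, hadj, hfst, hsnd, hcard⟩ := hM.exists_arcs hk
  exact hasCapMatching_of_arcs hH D hadj hfst hsnd hcard

end SimpleGraph

theorem mainTheorem3 {V : Type*} [Finite V] (K : Type*) [Field K] (G : SimpleGraph V)
    (hG : G.indepNum ≤ 2) :
    ((G.coverIdeal K).IsNormalIdeal ↔ (Gᶜ.edgeIdeal K).IsNormalIdeal) ∧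
    ((G.coverIdeal K).IsNormalIdeal ↔ ¬ Gᶜ.HasHochsterConfiguration) := by
  have h := SimpleGraph.isNormalIdeal_coverIdeal_iff_edgeIdeal_compl K hG
  exact ⟨h, h.trans
    (SimpleGraph.isNormalIdeal_edgeIdeal_iff_not_hasHochsterConfiguration K Gᶜ)⟩
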